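/- Let $p$ be a prime, let $n\ge 0$ be an integer, and let $\mathcal F$ be a family of subsets of $[n]=\{1,\dots,n\}$ that is $p$-wise $p$-divisible, meaning that $|A_1\cap\cdots\cap A_p|$ is divisible by $p$ for any (not necessarily distinct) $A_1,\dots,A_p\in\mathcal F$. Then $|\mathcal F|\le 2^{\lfloor n/p\rfloor}$. -/

import Mathlib

/-- A family `F` of subsets of an `n`-element set is `k`-wise `l`-divisible if
`|A 0 ∩ ⋯ ∩ A (k - 1)|` is divisible by `l` for any members `A 0, …, A (k - 1)` of `F`,
which need not be distinct. -/
def KWiseDivisible {n : ℕ} (k l : ℕ) (F : Finset (Finset (Fin n))) : Prop :=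
  ∀ A : Fin k → Finset (Fin n), (∀ i, A i ∈ F) → l ∣ (Finset.univ.inf A).card

open Module

/-! Put `q = p - 1`. Over an infinite field of characteristic `p`, let `V` be the span of the
indicator vectors of the family and `U` the span of `V` and `1`. Divisibility makes `V` orthogonal
to `U ^ q`, so `dim V + dim U ^ q ≤ n`. A Kneser type bound gives `dim U ^ q ≥ q (dim U - 1) + 1`,
unless the indicator of some proper nonempty `S` stabilises `U ^ q`. The two bounds yield `dim V ≤ n
/ p`, and `V` contains at most `2 ^ dim V` zero-one vectors. In the exceptional case the hypothesis
splits over `S` and its complement, and induction on the ground set applies. -/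

lemma finrank_map_of_injective {K M N : Type*} [Field K] [AddCommGroup M] [Module K M]
    [AddCommGroup N] [Module K N] {f : M →ₗ[K] N} (hf : Function.Injective f)
    (V : Submodule K M) : finrank K (V.map f) = finrank K V :=
  (Submodule.equivMapOfInjective f hf V).finrank_eq.symm

/-! ### Kneser type inequality for coordinatewise products -/

section SchurProduct

variable {ι K : Type*} [Fintype ι] [Field K]

/-- The indicator function of the set of points at which `v` takes the value `v i` is obtained
from `v` and the constants by multiplication. -/
lemma indicator_mul_mem_of_mul_mem {W : Submodule K (ι → K)} {v : ι → K}
    (h : ∀ w ∈ W, v * w ∈ W) (i : ι) :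
    ∀ w ∈ W, {j | v j = v i}.indicator 1 * w ∈ W := by
  classical
  -- Lagrange interpolation: for `s` the set where `v` differs from `v i`, the product is the
  -- indicator.
  have key : ∀ s : Finset ι, ∀ w ∈ W,
      (∏ j ∈ s, (v i - v j)⁻¹ • (v - fun _ ↦ v j)) * w ∈ W := by
    intro s
    induction s using Finset.induction_on with
    | empty => simp
    | insert a s ha ih =>
      intro w hw
      rw [Finset.prod_insert ha, mul_assoc, smul_mul_assoc, sub_mul]
      refine W.smul_mem _ (W.sub_mem (h _ (ih w hw)) ?_)
      exact W.smul_mem (v a) (ih w hw)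
  convert key {j | v j ≠ v i} using 4 with w
  ext x
  rw [Finset.prod_apply]
  by_cases hx : v x = v i
  · rw [Set.indicator_of_mem (by exact hx), Finset.prod_eq_one]
    · rfl
    · intro j hj
      have : v i - v j ≠ 0 := sub_ne_zero.2 (Ne.symm (by simpa using hj))
      simp [hx, this]
  · rw [Set.indicator_of_notMem (by exact hx), Finset.prod_eq_zero (i := x)]
    · simpa using hx
    · simp

/-- Over an infinite field, every function becomes nowhere zero after adding a constant. -/
lemma exists_add_const_ne_zero [Infinite K] (w : ι → K) : ∃ c : K, ∀ i, w i + c ≠ 0 := by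
  classical
  obtain ⟨c, hc⟩ := Infinite.exists_notMem_finset (Finset.univ.image fun i ↦ -w i)
  refine ⟨c, fun i hi ↦ hc ?_⟩
  simp only [Finset.mem_image, Finset.mem_univ, true_and]
  exact ⟨i, by linear_combination -hi⟩

lemma exists_indicator_mul_mem_of_mul_le [Nonempty ι] {V W : Submodule K (ι → K)}
    (h1V : 1 ∈ V) (hVW : V * W ≤ W) :
    finrank K V ≤ 1 ∨
      ∃ S : Set ι, S.Nonempty ∧ S ≠ Set.univ ∧ ∀ w ∈ W, S.indicator 1 * w ∈ W := by
  by_cases hconst : ∀ v ∈ V, ∀ i j, v i = v j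
  · left
    refine finrank_le_one ⟨1, h1V⟩ fun v ↦ ?_
    obtain ⟨i⟩ := ‹Nonempty ι›
    refine ⟨(v : ι → K) i, Subtype.ext (funext fun j ↦ ?_)⟩
    simpa using hconst v v.2 i j
  · right
    push Not at hconst
    obtain ⟨v, hv, i, j, hij⟩ := hconst
    refine ⟨{k | v k = v i}, ⟨i, rfl⟩, fun h ↦ hij ?_,
      indicator_mul_mem_of_mul_mem (fun w hw ↦ hVW (Submodule.mul_mem_mul hv hw)) i⟩
    exact (h.ge (Set.mem_univ j) : v j = v i).symm

variable [Infinite K]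

/-- The inductive step is the Dyson transform `V ∩ W e⁻¹`, `W + V e`. -/
lemma finrank_mul_or_exists_indicator_mul_mem [Nonempty ι] (V W : Submodule K (ι → K))
    (h1V : 1 ∈ V) (h1W : 1 ∈ W) :
    finrank K V + finrank K W ≤ finrank K ↥(V * W) + 1 ∨
      ∃ S : Set ι, S.Nonempty ∧ S ≠ Set.univ ∧ ∀ w ∈ W, S.indicator 1 * w ∈ V * W := by
  induction hd : finrank K V using Nat.strong_induction_on generalizing V W with
  | _ d ih =>
  subst hd
  have hle : W ≤ V * W := fun w hw ↦ by simpa using Submodule.mul_mem_mul h1V hw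
  by_cases hall : ∀ e ∈ W, (∀ i, e i ≠ 0) → ∀ v ∈ V, v * e ∈ W
  · have hVW : V * W ≤ W := by
      refine Submodule.mul_le.2 fun v hv w hw ↦ ?_
      -- Any `w` is a difference of the nowhere zero vector `w + c • 1` and a constant, to which
      -- `hall` applies.
      obtain ⟨c, hc⟩ := exists_add_const_ne_zero w
      have h1 := hall (w + c • 1) (W.add_mem hw (W.smul_mem c h1W)) (by simpa using hc) v hv
      have h2 := hall 1 h1W (by simp) v hv
      have : v * w = v * (w + c • 1) - c • (v * 1) := by
        ext i; simp; ring
      rw [this]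
      exact W.sub_mem h1 (W.smul_mem c h2)
    rcases exists_indicator_mul_mem_of_mul_le h1V hVW with h | ⟨S, hS, hS', h⟩
    · left
      have := Submodule.finrank_mono hle
      omega
    · exact .inr ⟨S, hS, hS', fun w hw ↦ hle (h w hw)⟩
  · push Not at hall
    obtain ⟨e, heW, he, v₀, hv₀, hv₀e⟩ := hall
    let μ : (ι → K) →ₗ[K] (ι → K) := LinearMap.mulRight K e
    have hμ : Function.Injective μ := by
      intro a b hab
      ext i
      exact mul_right_cancel₀ (he i) (congrFun hab i)
    -- Since `e` is nowhere zero, `V' e = W ∩ V e` has the dimension of `V'`, so the dimension sum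
    -- is kept, while `V'` loses `v₀`.
    set V' := V ⊓ W.comap μ
    set W' := W ⊔ V.map μ
    have hlt : finrank K V' < finrank K V := by
      refine Submodule.finrank_lt_finrank_of_lt (lt_of_le_of_ne inf_le_left fun h ↦ hv₀e ?_)
      exact (h.ge hv₀).2
    have hmul : V' * W' ≤ V * W := by
      rw [Submodule.mul_sup]
      refine sup_le (mul_le_mul' inf_le_left le_rfl) (Submodule.mul_le.2 ?_)
      rintro a ha _ ⟨b, hb, rfl⟩
      have : a * μ b = b * μ a := by
        simp only [μ, LinearMap.mulRight_apply]; ring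
      rw [this]
      exact Submodule.mul_mem_mul hb ha.2
    have hmap : V'.map μ = W ⊓ V.map μ := by
      ext x
      constructor
      · rintro ⟨a, ha, rfl⟩
        exact ⟨ha.2, a, ha.1, rfl⟩
      · rintro ⟨hx, a, ha, rfl⟩
        exact ⟨a, ⟨ha, hx⟩, rfl⟩
    have hdim : finrank K V' + finrank K W' = finrank K V + finrank K W := by
      have h1 := Submodule.finrank_sup_add_finrank_inf_eq W (V.map μ)
      rw [← hmap, finrank_map_of_injective hμ,
        finrank_map_of_injective hμ] at h1
      rw [add_comm, h1, add_comm]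
    rcases ih _ hlt V' W' ⟨h1V, by simpa [μ] using heW⟩ (Submodule.mem_sup_left h1W) rfl with
      h | ⟨S, hS, hS', h⟩
    · left
      have := Submodule.finrank_mono hmul
      omega
    · exact .inr ⟨S, hS, hS', fun w hw ↦ hmul (h w (Submodule.mem_sup_left hw))⟩

/-- Dividing `V` by `v` reduces to `1 ∈ V`. The set `S` may depend on `v`. -/
lemma finrank_mul_or_exists_indicator_mul_mul_mem [Nonempty ι] (V W : Submodule K (ι → K))
    (h1W : 1 ∈ W) {v : ι → K} (hv : v ∈ V) (hv0 : ∀ i, v i ≠ 0) :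
    finrank K V + finrank K W ≤ finrank K ↥(V * W) + 1 ∨
      ∃ S : Set ι, S.Nonempty ∧ S ≠ Set.univ ∧
        ∀ w ∈ W, S.indicator 1 * (v * w) ∈ V * W := by
  let μ : (ι → K) →ₗ[K] (ι → K) := LinearMap.mulLeft K v⁻¹
  have hinv : v * v⁻¹ = 1 := by ext i; simp [hv0 i]
  have hμ : Function.Injective μ := by
    intro a b hab
    ext i
    exact mul_left_cancel₀ (inv_ne_zero (hv0 i)) (congrFun hab i)
  have hmap : V.map μ * W = (V * W).map μ := by
    apply le_antisymm
    · refine Submodule.mul_le.2 ?_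
      rintro _ ⟨a, ha, rfl⟩ b hb
      exact ⟨a * b, Submodule.mul_mem_mul ha hb, (mul_assoc _ _ _).symm⟩
    · refine Submodule.map_le_iff_le_comap.2 (Submodule.mul_le.2 fun a ha b hb ↦ ?_)
      have : μ (a * b) = μ a * b := (mul_assoc _ _ _).symm
      rw [Submodule.mem_comap, this]
      exact Submodule.mul_mem_mul ⟨a, ha, rfl⟩ hb
  have := finrank_mul_or_exists_indicator_mul_mem (V.map μ) W
    ⟨v, hv, by simpa [μ, mul_comm] using hinv⟩ h1W
  rw [hmap, finrank_map_of_injective hμ,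
    finrank_map_of_injective hμ] at this
  refine this.imp_right ?_
  rintro ⟨S, hS, hS', h⟩
  refine ⟨S, hS, hS', fun w hw ↦ ?_⟩
  obtain ⟨x, hx, hxe⟩ := h w hw
  suffices hvx : S.indicator 1 * (v * w) = x from hvx ▸ hx
  calc S.indicator 1 * (v * w) = v * (S.indicator 1 * w) := by ring
    _ = (v * v⁻¹) * x := by rw [← hxe, mul_assoc]; rfl
    _ = x := by rw [hinv, one_mul]

/-- A Kneser type inequality for the coordinatewise product of subspaces of `ι → K`. -/
theorem finrank_add_finrank_le_of_indicator_mul_notMem [Nonempty ι] (V W : Submodule K (ι → K))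
    (h1V : 1 ∈ V) (h1W : 1 ∈ W)
    (hstab : ∀ S : Set ι, S.Nonempty → S ≠ Set.univ →
      ∃ x ∈ V * W, S.indicator 1 * x ∉ V * W) :
    finrank K V + finrank K W ≤ finrank K ↥(V * W) + 1 := by
  by_contra hlt
  -- If the bound fails, the subspaces `v i = 0` and `P S`, finite in number, cover `V`. As `K` is
  -- infinite, one of them is all of `V`; `1` rules out the first kind, and the second makes `S`
  -- stabilise `V * W`.
  let P (S : Set ι) : Submodule K (ι → K) :=
    ⨅ w : W, (V * W).comap (LinearMap.mulLeft K (S.indicator 1 * (w : ι → K)))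
  have hP (S : Set ι) (v : ι → K) : v ∈ P S ↔ ∀ w ∈ W, S.indicator 1 * (v * w) ∈ V * W := by
    simp only [P, Submodule.mem_iInf, Submodule.mem_comap, LinearMap.mulLeft_apply,
      Subtype.forall, mul_assoc, mul_comm v]
  let Q : ι ⊕ {S : Set ι // S.Nonempty ∧ S ≠ Set.univ} → Submodule K V :=
    Sum.elim (fun i ↦ LinearMap.ker (LinearMap.proj i ∘ₗ V.subtype))
      (fun S ↦ (P S).comap V.subtype)
  have hcover : ⋃ a, (Q a : Set V) = Set.univ := by
    refine Set.eq_univ_of_forall fun v ↦ Set.mem_iUnion.2 ?_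
    by_cases hv : ∀ i, (v : ι → K) i ≠ 0
    · obtain ⟨S, hS, hS', h⟩ :=
        (finrank_mul_or_exists_indicator_mul_mul_mem V W h1W v.2 hv).resolve_left hlt
      exact ⟨.inr ⟨S, hS, hS'⟩, (hP S v).2 h⟩
    · push Not at hv
      obtain ⟨i, hi⟩ := hv
      exact ⟨.inl i, hi⟩
  obtain ⟨a, ha⟩ := Subspace.exists_eq_top_of_iUnion_eq_univ hcover
  rcases a with i | ⟨S, hS, hS'⟩
  · have : (⟨1, h1V⟩ : V) ∈ Q (.inl i) := ha ▸ Submodule.mem_top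
    exact one_ne_zero (α := K) this
  · obtain ⟨x, hx, hxS⟩ := hstab S hS hS'
    have : V * W ≤ (V * W).comap (LinearMap.mulLeft K (S.indicator 1)) := by
      refine Submodule.mul_le.2 fun v hv w hw ↦ ?_
      have : (⟨v, hv⟩ : V) ∈ Q (.inr ⟨S, hS, hS'⟩) := ha ▸ Submodule.mem_top
      exact (hP S v).1 this w hw
    exact hxS (this hx)

theorem mul_finrank_le_finrank_pow [Nonempty ι] (U : Submodule K (ι → K)) (h1 : 1 ∈ U) (m : ℕ)
    (hstab : ∀ S : Set ι, S.Nonempty → S ≠ Set.univ →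
      ∃ x ∈ U ^ m, S.indicator 1 * x ∉ U ^ m) :
    m * finrank K U + 1 ≤ finrank K ↥(U ^ m) + m := by
  induction m with
  | zero =>
    have : (U ^ 0 : Submodule K (ι → K)) ≠ ⊥ := by
      rw [pow_zero, ne_eq, Submodule.eq_bot_iff]
      exact fun h ↦ one_ne_zero (h 1 (Submodule.one_le.1 le_rfl))
    have := Submodule.one_le_finrank_iff.2 this
    omega
  | succ m ih =>
    have h1m : (1 : ι → K) ∈ U ^ m := by simpa using Submodule.pow_mem_pow U h1 m
    have hm := ih fun S hS hS' ↦ by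
      by_contra! hcon
      obtain ⟨x, hx, hxS⟩ := hstab S hS hS'
      have : U ^ m * U ≤ (U ^ m * U).comap (LinearMap.mulLeft K (S.indicator 1)) := by
        refine Submodule.mul_le.2 fun a ha b hb ↦ ?_
        rw [Submodule.mem_comap, LinearMap.mulLeft_apply, ← mul_assoc]
        exact Submodule.mul_mem_mul (hcon a ha) hb
      exact hxS (this hx)
    rw [pow_succ] at hstab ⊢
    have := finrank_add_finrank_le_of_indicator_mul_notMem _ _ h1m h1 hstab
    rw [add_mul, one_mul]
    omega

end SchurProduct

/-! ### Zero-one vectors and orthogonality -/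

section ZeroOne

variable {ι K : Type*} [Fintype ι] [Field K]

/-- A subspace of dimension `d` contains at most `2 ^ d` vectors with all entries `0` or `1`. -/
lemma card_le_two_pow_finrank_span (F : Finset (ι → K))
    (h01 : ∀ f ∈ F, ∀ i, f i = 0 ∨ f i = 1) :
    F.card ≤ 2 ^ finrank K (Submodule.span K (F : Set (ι → K))) := by
  classical
  set V := Submodule.span K (F : Set (ι → K))
  -- At most `dim V` coordinates span all coordinate functionals on `V`, so they determine a vector
  -- of `V`.
  let φ : ι → Dual K V := fun i ↦ LinearMap.proj i ∘ₗ V.subtype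
  obtain ⟨r, hr', g, hg, hspan⟩ : ∃ r, r = finrank K (Submodule.span K (Set.range φ)) ∧
      ∃ g : Fin r → Dual K V, (∀ j, g j ∈ Set.range φ) ∧
        Submodule.span K (Set.range g) = Submodule.span K (Set.range φ) :=
    have ⟨g, hg, hspan, _⟩ := Submodule.exists_fun_fin_finrank_span_eq K (Set.range φ)
    ⟨_, rfl, g, hg, hspan⟩
  have hr : r ≤ finrank K V := hr'.le.trans <| (Submodule.finrank_le _).trans Subspace.dual_finrank_eq.le
  have hF (f : F) : (f : ι → K) ∈ V := Submodule.subset_span f.2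
  let c : F → Fin r → Bool := fun f j ↦ g j ⟨f, hF f⟩ = 1
  have hc : Function.Injective c := by
    intro f f' hff
    have hgeq (j) : g j ⟨f, hF f⟩ = g j ⟨f', hF f'⟩ := by
      obtain ⟨i, hi⟩ := hg j
      have h1 : g j ⟨f, hF f⟩ = (f : ι → K) i := by rw [← hi]; rfl
      have h2 : g j ⟨f', hF f'⟩ = (f' : ι → K) i := by rw [← hi]; rfl
      have h3 := congrFun hff j
      simp only [c, h1, h2, decide_eq_decide] at h3
      rw [h1, h2]
      rcases h01 f f.2 i with h | h <;> rcases h01 f' f'.2 i with h' | h' <;> simp_all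
    have hker : Submodule.span K (Set.range g) ≤
        LinearMap.ker (Dual.eval K V (⟨f, hF f⟩ - ⟨f', hF f'⟩)) := by
      rw [Submodule.span_le]
      rintro _ ⟨j, rfl⟩
      simp [hgeq]
    rw [hspan] at hker
    ext i
    have := hker (Submodule.subset_span ⟨i, rfl⟩)
    simpa [φ, sub_eq_zero] using this
  have := Fintype.card_le_of_injective c hc
  simp only [Fintype.card_coe, Fintype.card_fun, Fintype.card_bool, Fintype.card_fin] at this
  exact this.trans (Nat.pow_le_pow_right two_pos hr)

lemma finrank_add_finrank_le_card_of_dotProduct_eq_zero (V W : Submodule K (ι → K))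
    (h : ∀ v ∈ V, ∀ w ∈ W, v ⬝ᵥ w = 0) : finrank K V + finrank K W ≤ Fintype.card ι := by
  classical
  have hle : V.map (dotProductEquiv K ι).toLinearMap ≤ W.dualAnnihilator := by
    rintro _ ⟨v, hv, rfl⟩
    exact (Submodule.mem_dualAnnihilator _).2 fun w hw ↦ h v hv w hw
  have h1 := Submodule.finrank_mono hle
  rw [finrank_map_of_injective (dotProductEquiv K ι).injective] at h1
  have h2 := Subspace.finrank_add_finrank_dualAnnihilator_eq W
  rw [finrank_fintype_fun_eq_card] at h2
  omega

/-- The vanishing of all sums of products of `q + 1` members of `F` extends to the powers of the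
space spanned by `F` and the constants. -/
lemma dotProduct_eq_zero_of_mem_span_insert_one_pow {q : ℕ} {F : Finset (ι → K)}
    (h01 : ∀ f ∈ F, ∀ i, f i = 0 ∨ f i = 1)
    (hF : ∀ A : Fin (q + 1) → ι → K, (∀ k, A k ∈ F) → ∑ x, ∏ k, A k x = 0) :
    ∀ v ∈ Submodule.span K (F : Set (ι → K)),
      ∀ w ∈ Submodule.span K (insert 1 (F : Set (ι → K))) ^ q, v ⬝ᵥ w = 0 := by
  classical
  intro v hv w hw
  rw [Submodule.span_pow] at hw
  induction hv using Submodule.span_induction with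
  | zero => simp
  | add a b _ _ ha hb => rw [add_dotProduct, ha, hb, add_zero]
  | smul c a _ ha => rw [smul_dotProduct, ha, smul_zero]
  | mem f hf =>
  induction hw using Submodule.span_induction with
  | zero => simp
  | add a b _ _ ha hb => rw [dotProduct_add, ha, hb, add_zero]
  | smul c a _ ha => rw [dotProduct_smul, ha, smul_zero]
  | mem u hu =>
  obtain ⟨g, rfl⟩ := Set.mem_pow.1 hu
  rw [List.prod_ofFn]
  rw [dotProduct]
  -- A factor `1` may be replaced by `f`, since `f * f = f`.
  convert hF (Fin.cons f fun k ↦ if (g k : ι → K) ∈ F then g k else f) ?_ using 2 with x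
  · rw [Fin.prod_univ_succ, Finset.prod_apply]
    simp only [Fin.cons_zero, Fin.cons_succ]
    rcases h01 f hf x with hx | hx
    · simp [hx]
    · congr 1
      refine Finset.prod_congr rfl fun k _ ↦ ?_
      split_ifs with hk
      · rfl
      · have : (g k : ι → K) = 1 := (g k).2.resolve_right hk
        rw [this, hx, Pi.one_apply]
  · intro k
    refine Fin.cases hf (fun k ↦ ?_) k
    simp only [Fin.cons_succ]
    split_ifs with hk
    exacts [hk, hf]

lemma card_le_card_image_mul_card_image {ι K : Type*} (F : Finset (ι → K)) (S : Set ι)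
    [DecidableEq (S → K)] [DecidableEq (↥Sᶜ → K)] :
    F.card ≤ (F.image fun f (i : S) ↦ f i).card * (F.image fun f (i : ↥Sᶜ) ↦ f i).card := by
  rw [← Finset.card_product]
  refine Finset.card_le_card_of_injOn (fun f ↦ (fun i ↦ f i, fun i ↦ f i)) ?_ ?_
  · intro f hf
    simp only [Finset.coe_product, Set.mem_prod, Finset.mem_coe, Finset.mem_image]
    exact ⟨⟨f, hf, rfl⟩, ⟨f, hf, rfl⟩⟩
  · intro f _ g _ hfg
    ext i
    by_cases hi : i ∈ S
    · exact congrFun (Prod.ext_iff.1 hfg).1 ⟨i, hi⟩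
    · exact congrFun (Prod.ext_iff.1 hfg).2 ⟨i, hi⟩

end ZeroOne

/-! ### The bound for divisible families -/

/-- If no nontrivial indicator function stabilises the `q`-th power of the space spanned by `F`
and the constants, then `F` spans a space of dimension at most `|ι| / (q + 1)`. -/
lemma finrank_span_mul_le_card {ι K : Type*} [Fintype ι] [Nonempty ι] [Field K] [Infinite K]
    {q : ℕ} [CharP K (q + 1)] {F : Finset (ι → K)}
    (hperp : ∀ v ∈ Submodule.span K (F : Set (ι → K)),
      ∀ w ∈ Submodule.span K (insert 1 (F : Set (ι → K))) ^ q, v ⬝ᵥ w = 0)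
    (hstab : ∀ S : Set ι, S.Nonempty → S ≠ Set.univ →
      ∃ x ∈ Submodule.span K (insert 1 (F : Set (ι → K))) ^ q,
        S.indicator 1 * x ∉ Submodule.span K (insert 1 (F : Set (ι → K))) ^ q) :
    finrank K (Submodule.span K (F : Set (ι → K))) ≤ Fintype.card ι / (q + 1) := by
  set V := Submodule.span K (F : Set (ι → K)) with hV
  set U := Submodule.span K (insert 1 (F : Set (ι → K))) with hU
  have h1U : (1 : ι → K) ∈ U := Submodule.subset_span (Set.mem_insert _ _)
  have hdim := finrank_add_finrank_le_card_of_dotProduct_eq_zero V (U ^ q) hperp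
  have hpow := mul_finrank_le_finrank_pow U h1U q hstab
  have hVU : V ≤ U := Submodule.span_mono (Set.subset_insert _ _)
  by_cases h1V : (1 : ι → K) ∈ V
  · have hUV : U = V := Submodule.span_insert_eq_span h1V
    -- Here `U = V` only gives `(q + 1) dim V ≤ |ι| + q - 1`, but `1 ⊥ 1` makes `|ι|` divisible by
    -- `q + 1`, which absorbs the excess.
    have h := hperp 1 h1V 1 (by simpa using Submodule.pow_mem_pow U h1U q)
    simp only [dotProduct_one, Pi.one_apply, Finset.sum_const, Finset.card_univ, nsmul_eq_mul,
      mul_one] at h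
    obtain ⟨t, ht⟩ := (CharP.cast_eq_zero_iff K (q + 1) _).1 h
    rw [hUV] at hpow hdim
    rw [ht, Nat.mul_div_cancel_left _ q.succ_pos]
    by_contra! hlt
    have : (q + 1) * (t + 1) ≤ (q + 1) * finrank K V := Nat.mul_le_mul_left _ hlt
    have e : (q + 1) * finrank K V = q * finrank K V + finrank K V := by ring
    have e' : (q + 1) * (t + 1) = (q + 1) * t + q + 1 := by ring
    omega
  · have hlt : finrank K V < finrank K U :=
      Submodule.finrank_lt_finrank_of_lt (lt_of_le_of_ne hVU fun h ↦ h1V (h ▸ h1U))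
    rw [Nat.le_div_iff_mul_le q.succ_pos, Nat.succ_eq_add_one]
    have h := Nat.mul_le_mul_left q hlt
    have e : finrank K V * (q + 1) = q * finrank K V + finrank K V := by ring
    rw [Nat.mul_succ] at h
    omega

/-- A family of zero-one functions all of whose `(q + 1)`-fold products sum to zero in
characteristic `q + 1` has at most `2 ^ (|ι| / (q + 1))` members. -/
theorem card_le_of_sum_prod_eq_zero {K : Type*} [Field K] [Infinite K] {q : ℕ}
    [CharP K (q + 1)] {ι : Type*} [Fintype ι] (F : Finset (ι → K))
    (h01 : ∀ f ∈ F, ∀ i, f i = 0 ∨ f i = 1)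
    (hF : ∀ A : Fin (q + 1) → ι → K, (∀ k, A k ∈ F) → ∑ x, ∏ k, A k x = 0) :
    F.card ≤ 2 ^ (Fintype.card ι / (q + 1)) := by
  classical
  induction hn : Fintype.card ι using Nat.strong_induction_on generalizing ι with
  | _ n ih =>
  subst hn
  have hperp := dotProduct_eq_zero_of_mem_span_insert_one_pow h01 hF
  rcases isEmpty_or_nonempty ι with hι | hι
  · exact (Finset.card_le_one_of_subsingleton F).trans Nat.one_le_two_pow
  by_cases hstab : ∀ S : Set ι, S.Nonempty → S ≠ Set.univ →
      ∃ x ∈ Submodule.span K (insert 1 (F : Set (ι → K))) ^ q,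
        S.indicator 1 * x ∉ Submodule.span K (insert 1 (F : Set (ι → K))) ^ q
  · exact (card_le_two_pow_finrank_span F h01).trans
      (Nat.pow_le_pow_right two_pos (finrank_span_mul_le_card hperp hstab))
  push Not at hstab
  obtain ⟨S, hS, hS', h⟩ := hstab
  -- The last `q` factors multiply to an element of `U ^ q`, which stays there after multiplication
  -- by the indicator of `S`, hence is orthogonal to `A 0`.
  have hsum (A : Fin (q + 1) → ι → K) (hA : ∀ k, A k ∈ F) :
      ∑ x, S.indicator (fun x ↦ ∏ k, A k x) x = 0 := by
    have hmem : ∏ k : Fin q, A k.succ ∈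
        Submodule.span K (insert 1 (F : Set (ι → K))) ^ q := by
      rw [Submodule.span_pow]
      refine Submodule.subset_span (Set.mem_pow.2
        ⟨fun k ↦ ⟨A k.succ, Set.mem_insert_of_mem _ (hA _)⟩, ?_⟩)
      rw [List.prod_ofFn]
    rw [← hperp _ (Submodule.subset_span (hA 0)) _ (h _ hmem), dotProduct]
    refine Finset.sum_congr rfl fun x _ ↦ ?_
    by_cases hx : x ∈ S <;> simp [hx, Fin.prod_univ_succ]
  have hsumc (A : Fin (q + 1) → ι → K) (hA : ∀ k, A k ∈ F) :
      ∑ x, Sᶜ.indicator (fun x ↦ ∏ k, A k x) x = 0 := by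
    have h0 := hF A hA
    change ∑ x, (fun x ↦ ∏ k, A k x) x = 0 at h0
    rw [← Set.indicator_self_add_compl S (fun x ↦ ∏ k, A k x)] at h0
    simpa only [Pi.add_apply, Finset.sum_add_distrib, hsum A hA, zero_add] using h0
  have hrestrict (T : Set ι) [DecidableEq (T → K)] (hT : T ≠ Set.univ)
      (hTsum : ∀ A : Fin (q + 1) → ι → K, (∀ k, A k ∈ F) →
        ∑ x, T.indicator (fun x ↦ ∏ k, A k x) x = 0) :
      (F.image fun f (i : T) ↦ f i).card ≤ 2 ^ (T.ncard / (q + 1)) := by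
    rw [← Nat.card_coe_set_eq, Nat.card_eq_fintype_card]
    refine ih _ ?_ _ ?_ ?_ rfl
    · obtain ⟨x, hx⟩ := (Set.ne_univ_iff_exists_notMem T).1 hT
      exact Fintype.card_subtype_lt hx
    · simp only [Finset.mem_image]
      rintro _ ⟨f, hf, rfl⟩ i
      exact h01 f hf i
    · intro A hA
      simp only [Finset.mem_image] at hA
      choose B hB hBA using hA
      rw [← hTsum B hB, Finset.sum_indicator_eq_sum_filter,
        Finset.sum_subtype _ (F := inferInstanceAs (Fintype T)) (p := (· ∈ T)) (by simp)]
      simp only [← hBA]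
  calc F.card ≤ _ := card_le_card_image_mul_card_image F S
    _ ≤ 2 ^ (S.ncard / (q + 1)) * 2 ^ (Sᶜ.ncard / (q + 1)) :=
      Nat.mul_le_mul (hrestrict S hS' hsum)
        (hrestrict Sᶜ (fun h ↦ hS.ne_empty (Set.compl_univ_iff.1 h)) hsumc)
    _ ≤ 2 ^ (Fintype.card ι / (q + 1)) := by
      rw [← pow_add]
      refine Nat.pow_le_pow_right two_pos (Nat.div_add_div_le_add_div.trans_eq ?_)
      rw [Set.ncard_add_ncard_compl, Nat.card_eq_fintype_card]

theorem theorem1 (p : ℕ) (hp : p.Prime) (n : ℕ) (F : Finset (Finset (Fin n)))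
    (hF : KWiseDivisible p p F) : F.card ≤ 2 ^ (n / p) := by
  classical
  obtain ⟨q, rfl⟩ : ∃ q, p = q + 1 := ⟨p - 1, (Nat.sub_add_cancel hp.one_le).symm⟩
  have : Fact (q + 1).Prime := ⟨hp⟩
  -- Any infinite field of characteristic `p` would do.
  let K := AlgebraicClosure (ZMod (q + 1))
  have : CharP K (q + 1) := charP_of_injective_algebraMap
    (algebraMap (ZMod (q + 1)) K).injective _
  have : Infinite K := IsAlgClosed.instInfinite
  let χ : Finset (Fin n) → Fin n → K := fun A i ↦ if i ∈ A then 1 else 0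
  have hχ : Function.Injective χ := by
    intro A B hAB
    ext i
    have := congrFun hAB i
    by_cases hA : i ∈ A <;> by_cases hB : i ∈ B <;> simp_all [χ]
  have := card_le_of_sum_prod_eq_zero (K := K) (q := q) (F.image χ) ?_ ?_
  · rwa [Finset.card_image_of_injective _ hχ, Fintype.card_fin] at this
  · simp only [Finset.mem_image]
    rintro _ ⟨A, -, rfl⟩ i
    by_cases hi : i ∈ A <;> simp [χ, hi]
  · intro A hA
    simp only [Finset.mem_image] at hA
    choose B hB hBA using hA
    rw [← (CharP.cast_eq_zero_iff K (q + 1) _).2 (hF B hB)]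
    simp only [← hBA, χ, Finset.prod_ite_zero, Finset.prod_const_one]
    rw [Finset.sum_boole]
    congr 2
    ext x
    simp [Finset.mem_inf]
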